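/- Let $G$ be a second countable, locally compact Hausdorff, unimodular group with Haar measure $\mu_G$ and identity $e_G$. Let $\mathcal H_\pi$ be a complex Hilbert space (inner product linear in the first variable), let $\sigma : G\times G\to\mathbb T$, and let $\pi : G\to\mathcal U(\mathcal H_\pi)$ be a discrete series $\sigma$-representation. That is, $\pi(e_G)=\mathrm{id}$ and $\pi(x)\pi(y)=\sigma(x,y)\pi(xy)$ for $x,y\in G$; every function $x\mapsto\langle f,\pi(x)g\rangle$ is Borel measurable; $\mathcal H_\pi\neq 0$ and its only closed $\pi$-invariant subspaces are $0$ and $\mathcal H_\pi$; and $\int_G|\langle\eta,\pi(x)\eta\rangle|^2\,d\mu_G(x)<\infty$ for some $\eta\ne 0$. Let $\Gamma\le G$ be a lattice, i.e. a discrete subgroup such that $G/\Gamma$ admits a non-zero finite $G$-invariant Radon measure. Let $\mathcal B_\pi$ be the set of Bessel vectors, i.e. of those $\eta\in\mathcal H_\pi$ for which $f\mapsto(\langle f,\pi(\gamma)\eta\rangle)_{\gamma\in\Gamma}$ is a bounded operator $\mathcal H_\pi\to\ell^2(\Gamma)$, and let $\pi(\Gamma)''$ be the double commutant of $\pi(\Gamma)$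 in $B(\mathcal H_\pi)$. (i) For every $T\in\pi(\Gamma)''$ there exists $c\in\ell^2(\Gamma)$ such that $$T\eta=\sum_{\gamma\in\Gamma}c_\gamma\,\pi(\gamma)\eta\qquad\text{for all }\eta\in\mathcal B_\pi,\tag{1}$$ where the series converges unconditionally in norm. (ii) Let $\Lambda\subseteq\Gamma$ be a finite subgroup, and let $u:\Lambda\to\mathbb C$ satisfy $\sigma(\gamma,\gamma')=u(\gamma)u(\gamma')\overline{u(\gamma\gamma')}$ for all $\gamma,\gamma'\in\Lambda$. Let $$p=\frac1{|\Lambda|}\sum_{\gamma'\in\Lambda}\overline{u(\gamma')}\,\pi(\gamma').$$ If $T\in\pi(\Gamma)''$ and $c\in\ell^2(\Gamma)$ satisfy (1), then the sequence $$c'_\gamma=\frac1{|\Lambda|}\sum_{\gamma'\in\Lambda}c_{\gamma\gamma'}\,\overline{u((\gamma')^{-1})}\,\sigma(\gamma\gamma',(\gamma')^{-1}),\qquad\gamma\in\Gamma,$$ belongs to $\ell^2(\Gamma)$ and satisfies $Tp\,\eta=\sum_{\gamma\in\Gamma}c'_\gamma\,\pi(\gamma)\eta$ for all $\eta\in\mathcal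 B_\pi$, again with unconditional norm convergence. -/

import Mathlib

open MeasureTheory
open scoped ENNReal ComplexConjugate

namespace DiscreteSeriesLattice

section Representations

variable {G : Type*} [Group G]
variable {H : Type*} [NormedAddCommGroup H] [InnerProductSpace ℂ H] [CompleteSpace H]

/-- A (measurable) `σ`-representation: a map `π` from `G` to the unitary operators on `H` with
`π(e) = id`, `π(x) π(y) = σ(x, y) π(xy)` and Borel measurable matrix coefficients. -/
structure IsSigmaRep [MeasurableSpace G] (σ : G → G → Circle) (π : G → unitary (H →L[ℂ] H)) :
    Prop where
  map_one : π 1 = 1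
  map_mul : ∀ x y : G,
    (π x : H →L[ℂ] H) * (π y : H →L[ℂ] H) = (σ x y : ℂ) • (π (x * y) : H →L[ℂ] H)
  measurable_coeff : ∀ f g : H, Measurable fun x : G => inner ℂ f ((π x : H →L[ℂ] H) g)

/-- Topological irreducibility: `H ≠ 0`, and the only closed invariant subspaces are `0` and `H`. -/
structure IsIrreducible (π : G → unitary (H →L[ℂ] H)) : Prop where
  nontrivial : Nontrivial H
  eq_bot_or_eq_top : ∀ K : Submodule ℂ H, IsClosed (K : Set H) →
    (∀ x : G, ∀ v ∈ K, (π x : H →L[ℂ] H) v ∈ K) → K = ⊥ ∨ K = ⊤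

/-- Square-integrability: some nonzero `η` satisfies `∫ |⟨η, π(x) η⟩|² dμ(x) < ∞`. -/
def IsSquareIntegrable [MeasurableSpace G] (μ : Measure G) (π : G → unitary (H →L[ℂ] H)) : Prop :=
  ∃ η : H, η ≠ 0 ∧ ∫⁻ x : G, ‖inner ℂ η ((π x : H →L[ℂ] H) η)‖ₑ ^ 2 ∂μ < ∞

/-- A discrete series `σ`-representation: irreducible and square-integrable. -/
structure IsDiscreteSeries [MeasurableSpace G] (μ : Measure G) (σ : G → G → Circle)
    (π : G → unitary (H →L[ℂ] H)) : Prop where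
  isSigmaRep : IsSigmaRep σ π
  isIrreducible : IsIrreducible π
  isSquareIntegrable : IsSquareIntegrable μ π

/-- `η` is a Bessel vector for `π` restricted to `Γ`: the coefficient map
`C_η f = (⟨f, π(γ) η⟩)_γ` (with `⟨·, ·⟩` linear in the first variable, so that `⟨f, g⟩` is
`inner ℂ g f`) is a bounded operator from `H` to `ℓ²(Γ)`. -/
def IsBesselVector (π : G → unitary (H →L[ℂ] H)) (Γ : Subgroup G) (η : H) : Prop :=
  ∃ C : H →L[ℂ] lp (fun _ : Γ => ℂ) 2, ∀ (f : H) (γ : Γ),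
    C f γ = inner ℂ ((π (γ : G) : H →L[ℂ] H) η) f

/-- The von Neumann algebra `π(Γ)''`, the double commutant of `π(Γ)` in `B(H)`. -/
def bicommutant (π : G → unitary (H →L[ℂ] H)) (Γ : Subgroup G) : Set (H →L[ℂ] H) :=
  Set.centralizer (Set.centralizer ((fun x : G => (π x : H →L[ℂ] H)) '' (Γ : Set G)))

/-- The operator `p = |Λ|⁻¹ ∑_{γ' ∈ Λ} conj(u(γ')) π(γ')`. -/
noncomputable def averagingOperator (π : G → unitary (H →L[ℂ] H)) {Γ : Subgroup G}
    (Λ : Subgroup Γ) [Fintype Λ] (u : Λ → ℂ) : H →L[ℂ] H :=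
  (Fintype.card Λ : ℂ)⁻¹ •
    ∑ l : Λ, conj (u l) • (π ((l : Γ) : G) : H →L[ℂ] H)

/-- The sequence
`c'_γ = |Λ|⁻¹ ∑_{γ' ∈ Λ} c_{γ γ'} conj(u(γ'⁻¹)) σ(γ γ', γ'⁻¹)`. -/
noncomputable def averagedCoeff (σ : G → G → Circle) {Γ : Subgroup G}
    (Λ : Subgroup Γ) [Fintype Λ] (u : Λ → ℂ) (c : Γ → ℂ) (γ : Γ) : ℂ :=
  (Fintype.card Λ : ℂ)⁻¹ *
    ∑ l : Λ, c (γ * l) * conj (u l⁻¹) *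
      (σ ((γ * l : Γ) : G) (((l : Γ)⁻¹ : Γ) : G) : ℂ)

end Representations

/-- A lattice: a discrete subgroup `Γ` such that `G ⧸ Γ` admits a nonzero finite `G`-invariant
Radon measure on its Borel sets. -/
structure IsLattice {G : Type*} [Group G] [TopologicalSpace G] (Γ : Subgroup G) : Prop where
  discrete : DiscreteTopology Γ
  exists_measure : letI : MeasurableSpace (G ⧸ Γ) := borel (G ⧸ Γ)
    ∃ ν : Measure (G ⧸ Γ), ν ≠ 0 ∧ IsFiniteMeasure ν ∧ ν.Regular ∧
      ∀ g : G, ν.map (fun q : G ⧸ Γ => g • q) = ν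

end DiscreteSeriesLattice

/-! For a Bessel vector `η` with coefficient operator `C_η`, the series in (1) is `C_η† c`, so (i)
asks for one `c` with `C_η† c = T η` for all `η`. Such a `c` represents the functional `∑ C_η f_η ↦
∑ ⟨f_η, T η⟩`, whose value is the coordinate at `1` of `∑ C_η T† f_η`. Boundedness
(`norm_sum_apply_le_of_commute`) holds because `T†` commutes with every `C_ξ† C_η`, an operator in
the commutant of `π(Γ)`. For (ii), expand `T` at the Bessel vectors `π(l⁻¹) η` and reindex. -/

open ContinuousLinearMap in
/-- An operator commuting with all `(C j)† ∘ C i` acts boundedly, with norm at most its own, on the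
sums `∑ C i (F i)`. -/
theorem norm_sum_apply_le_of_commute {ι H E : Type*} [NormedAddCommGroup H]
    [InnerProductSpace ℂ H] [CompleteSpace H] [NormedAddCommGroup E] [InnerProductSpace ℂ E]
    [CompleteSpace E] (C : ι → H →L[ℂ] E) (S : H →L[ℂ] H)
    (hS : ∀ i j, Commute S (adjoint (C j) ∘L C i)) (s : Finset ι) (F : ι → H) :
    ‖∑ i ∈ s, C i (S (F i))‖ ≤ ‖S‖ * ‖∑ i ∈ s, C i (F i)‖ := by
  have move : ∀ N : H →L[ℂ] H, (∀ i j, Commute N (adjoint (C j) ∘L C i)) → ∀ F' : ι → H,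
      inner ℂ (∑ i ∈ s, C i (F' i)) (∑ i ∈ s, C i (N (F i)))
        = inner ℂ (∑ i ∈ s, C i (star N (F' i))) (∑ i ∈ s, C i (F i)) := by
    intro N hN F'
    simp only [sum_inner, inner_sum]
    refine Finset.sum_congr rfl fun i _ => Finset.sum_congr rfl fun j _ => ?_
    rw [← adjoint_inner_right, ← adjoint_inner_right, star_eq_adjoint, adjoint_inner_left]
    exact congrArg (inner ℂ _) (DFunLike.congr_fun (hN i j).eq (F i)).symm
  have hstar : ∀ N : H →L[ℂ] H, (∀ i j, Commute N (adjoint (C j) ∘L C i)) →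
      ∀ i j, Commute (star N) (adjoint (C j) ∘L C i) := by
    intro N hN i j
    have h := (hN j i).star_star
    rwa [star_eq_adjoint (adjoint (C i) ∘L C j), adjoint_comp, adjoint_adjoint] at h
  -- The defect `‖S‖² - S†S` is positive, and its square root inherits the commutation by functional
  -- calculus; its contribution is exactly the gap in the squared inequality.
  set X : H →L[ℂ] H := algebraMap ℝ (H →L[ℂ] H) (‖S‖ ^ 2) - star S * S with hX
  have hX0 : 0 ≤ X := sub_nonneg.2 CStarAlgebra.star_mul_le_algebraMap_norm_sq
  have hY : ∀ i j, Commute (CFC.sqrt X) (adjoint (C j) ∘L C i) := by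
    intro i j
    refine Commute.cfcₙ_nnreal (Commute.sub_left ?_ ((hstar S hS i j).mul_left (hS i j))) _
    exact Algebra.commutes _ _
  have hsa : star (CFC.sqrt X) = CFC.sqrt X := (CFC.sqrt_nonneg X).isSelfAdjoint
  have key : inner ℂ (∑ i ∈ s, C i (S (F i))) (∑ i ∈ s, C i (S (F i)))
      + inner ℂ (∑ i ∈ s, C i (CFC.sqrt X (F i))) (∑ i ∈ s, C i (CFC.sqrt X (F i)))
      = ((‖S‖ ^ 2 : ℝ) : ℂ) * inner ℂ (∑ i ∈ s, C i (F i)) (∑ i ∈ s, C i (F i)) := by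
    rw [move S hS, move _ hY, hsa, ← inner_add_left, ← Finset.sum_add_distrib]
    have : ∀ i, C i (star S (S (F i))) + C i (CFC.sqrt X (CFC.sqrt X (F i)))
        = ((‖S‖ ^ 2 : ℝ) : ℂ) • C i (F i) := by
      intro i
      rw [← map_add, ← map_smul]
      congr 1
      have h := DFunLike.congr_fun (CFC.sqrt_mul_sqrt_self X hX0) (F i)
      rw [mul_apply_eq_comp] at h
      rw [h, hX, sub_apply, mul_apply_eq_comp, add_sub_cancel, Algebra.algebraMap_eq_smul_one, smul_apply,
        one_apply_eq_self, Complex.coe_smul]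
    simp only [this]
    rw [← Finset.smul_sum, inner_smul_left, Complex.conj_ofReal]
  simp only [inner_self_eq_norm_sq_to_K] at key
  have key' : ‖∑ i ∈ s, C i (S (F i))‖ ^ 2 + ‖∑ i ∈ s, C i (CFC.sqrt X (F i))‖ ^ 2
      = ‖S‖ ^ 2 * ‖∑ i ∈ s, C i (F i)‖ ^ 2 := by
    have h := congrArg Complex.re key
    simp only [Complex.add_re, Complex.re_ofReal_mul] at h
    exact_mod_cast h
  refine abs_le_of_sq_le_sq' ?_ (by positivity) |>.2
  rw [mul_pow, ← key']
  exact le_add_of_nonneg_right (sq_nonneg _)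

/-- A linear functional dominated by the norm of a linear map `A` with values in a Hilbert space is
represented by a vector of that space. -/
theorem exists_inner_eq_of_norm_le {V E : Type*} [AddCommGroup V] [Module ℂ V]
    [NormedAddCommGroup E] [InnerProductSpace ℂ E] [CompleteSpace E] (A : V →ₗ[ℂ] E)
    (φ : V →ₗ[ℂ] ℂ) (K : ℝ) (h : ∀ v, ‖φ v‖ ≤ K * ‖A v‖) :
    ∃ c : E, ∀ v, inner ℂ c (A v) = φ v := by
  -- `g` is a merely linear section of `A`; the bound `h` makes `φ ∘ g` continuous on the range.
  obtain ⟨g, hg⟩ := A.rangeRestrict.exists_rightInverse_of_surjective A.range_rangeRestrict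
  have hAg : ∀ y, A (g y) = y := fun y => congrArg Subtype.val (LinearMap.congr_fun hg y)
  obtain ⟨ψ, hψ, -⟩ := exists_extension_norm_eq (LinearMap.range A)
    ((φ ∘ₗ g).mkContinuous K fun y => by
      have := h (g y)
      rwa [hAg] at this)
  refine ⟨(InnerProductSpace.toDual ℂ E).symm ψ, fun v => ?_⟩
  rw [InnerProductSpace.toDual_symm_apply]
  refine (hψ ⟨A v, v, rfl⟩).trans (?_ : φ (g ⟨A v, v, rfl⟩) = φ v)
  -- The two arguments differ by an element of `ker A`, on which `h` forces `φ = 0`.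
  rw [← sub_eq_zero, ← map_sub, ← norm_le_zero_iff]
  refine (h _).trans ?_
  rw [map_sub, hAg]
  simp

/-- Square-summability is stable under a bijective reindexing and multiplication by a bounded
weight. -/
theorem memℓp_two_mul_comp_equiv {α : Type*} {a : α → ℂ} (ha : Memℓp a 2) (w : α → ℂ)
    (hw : ∀ i, ‖w i‖ = 1) (e : α ≃ α) : Memℓp (fun i => w i * a (e i)) 2 := by
  rw [memℓp_gen_iff (by norm_num)] at ha ⊢
  simp only [norm_mul, hw, one_mul]
  exact e.summable_iff.2 ha

/-! ### Coefficient operators of Bessel vectors and the expansion of `T` -/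

namespace DiscreteSeriesLattice

variable {G : Type*} [Group G]
variable {H : Type*} [NormedAddCommGroup H] [InnerProductSpace ℂ H] [CompleteSpace H]
variable {σ : G → G → Circle} {π : G → unitary (H →L[ℂ] H)} {Γ : Subgroup G}

theorem IsSigmaRep.apply_apply [MeasurableSpace G] (hπ : IsSigmaRep σ π) (x y : G) (v : H) :
    (π x : H →L[ℂ] H) ((π y : H →L[ℂ] H) v) = (σ x y : ℂ) • (π (x * y) : H →L[ℂ] H) v :=
  DFunLike.congr_fun (hπ.map_mul x y) v

theorem inner_unitary_apply (U : unitary (H →L[ℂ] H)) (v w : H) :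
    inner ℂ ((U : H →L[ℂ] H) v) ((U : H →L[ℂ] H) w) = inner ℂ v w := by
  rw [← ContinuousLinearMap.adjoint_inner_right, ← ContinuousLinearMap.star_eq_adjoint,
    ← mul_apply_eq_comp, Unitary.coe_star_mul_self, one_apply_eq_self]

theorem circle_conj_mul_self (z : Circle) : conj (z : ℂ) * z = 1 := by
  rw [mul_comm, Complex.mul_conj, Circle.normSq_coe, Complex.ofReal_one]

/-- The range of the coefficient maps transforms under `π γ` by a twisted translation, so inner
products of coefficient sequences are invariant. -/
theorem IsSigmaRep.inner_coeff_apply [MeasurableSpace G] (hπ : IsSigmaRep σ π) {η ξ : H}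
    {C D : H →L[ℂ] lp (fun _ : Γ => ℂ) 2}
    (hC : ∀ (f : H) (γ : Γ), C f γ = inner ℂ ((π (γ : G) : H →L[ℂ] H) η) f)
    (hD : ∀ (f : H) (γ : Γ), D f γ = inner ℂ ((π (γ : G) : H →L[ℂ] H) ξ) f)
    (γ : Γ) (f g : H) :
    inner ℂ (D ((π (γ : G) : H →L[ℂ] H) g)) (C ((π (γ : G) : H →L[ℂ] H) f))
      = inner ℂ (D g) (C f) := by
  have translate : ∀ (v h : H) (γ' : Γ),
      inner ℂ ((π ((γ * γ' : Γ) : G) : H →L[ℂ] H) v) ((π (γ : G) : H →L[ℂ] H) h)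
        = (σ γ γ' : ℂ) * inner ℂ ((π (γ' : G) : H →L[ℂ] H) v) h := by
    intro v h γ'
    rw [← inner_unitary_apply (π γ) ((π (γ' : G) : H →L[ℂ] H) v) h, hπ.apply_apply,
      inner_smul_left, ← mul_assoc, mul_comm (σ _ _ : ℂ), circle_conj_mul_self, one_mul,
      Subgroup.coe_mul]
  -- After left translation by `γ`, the phase `σ(γ, γ')` meets its own conjugate and cancels.
  rw [lp.inner_eq_tsum, lp.inner_eq_tsum, ← (Equiv.mulLeft γ).tsum_eq]
  refine tsum_congr fun γ' => ?_
  rw [Equiv.coe_mulLeft, hC, hD, hC, hD, translate, translate, RCLike.inner_apply,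
    RCLike.inner_apply, _root_.map_mul (starRingEnd ℂ)]
  linear_combination (inner ℂ ((π (γ' : G) : H →L[ℂ] H) η) f *
    conj (inner ℂ ((π (γ' : G) : H →L[ℂ] H) ξ) g)) * circle_conj_mul_self (σ γ γ')

open ContinuousLinearMap in
/-- The mixed frame operators of Bessel vectors lie in the commutant of `π(Γ)`. -/
theorem IsSigmaRep.commute_adjoint_comp [MeasurableSpace G] (hπ : IsSigmaRep σ π) {η ξ : H}
    {C D : H →L[ℂ] lp (fun _ : Γ => ℂ) 2}
    (hC : ∀ (f : H) (γ : Γ), C f γ = inner ℂ ((π (γ : G) : H →L[ℂ] H) η) f)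
    (hD : ∀ (f : H) (γ : Γ), D f γ = inner ℂ ((π (γ : G) : H →L[ℂ] H) ξ) f)
    {T : H →L[ℂ] H} (hT : T ∈ bicommutant π Γ) : Commute T (adjoint D ∘L C) := by
  refine (Set.mem_centralizer_iff.1 hT _ (Set.mem_centralizer_iff.2 ?_)).symm
  rintro _ ⟨γ, hγ, rfl⟩
  refine ContinuousLinearMap.ext fun f => ext_inner_left ℂ fun g => ?_
  obtain ⟨h, rfl⟩ : ∃ h, (π γ : H →L[ℂ] H) h = g :=
    ⟨((star (π γ) : unitary (H →L[ℂ] H)) : H →L[ℂ] H) g, by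
      rw [← mul_apply_eq_comp, Unitary.coe_mul_star_self, one_apply_eq_self]⟩
  have := hπ.inner_coeff_apply hC hD ⟨γ, hγ⟩ f h
  rw [mul_apply_eq_comp, mul_apply_eq_comp, inner_unitary_apply, comp_apply, comp_apply,
    adjoint_inner_right, adjoint_inner_right]
  exact this.symm

open ContinuousLinearMap in
/-- The synthesis operator of a Bessel vector: its series converge unconditionally. -/
theorem hasSum_smul_of_coeff {η : H} {C : H →L[ℂ] lp (fun _ : Γ => ℂ) 2}
    (hC : ∀ (f : H) (γ : Γ), C f γ = inner ℂ ((π (γ : G) : H →L[ℂ] H) η) f)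
    (c : lp (fun _ : Γ => ℂ) 2) :
    HasSum (fun γ : Γ => c γ • (π (γ : G) : H →L[ℂ] H) η) (adjoint C c) := by
  classical
  -- `adjoint C` sends the unit vector at `γ` to `π(γ) η`.
  refine ((lp.hasSum_single (by norm_num) c).mapL (adjoint C)).congr_fun fun γ => ?_
  refine ext_inner_right ℂ fun f => ?_
  rw [adjoint_inner_left, lp.inner_single_left, hC, inner_smul_left, RCLike.inner_apply, mul_comm]

open ContinuousLinearMap in
theorem IsSigmaRep.exists_coeff [MeasurableSpace G] (hπ : IsSigmaRep σ π) {T : H →L[ℂ] H}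
    (hT : T ∈ bicommutant π Γ) :
    ∃ c : Γ → ℂ, Memℓp c 2 ∧ ∀ η : H, IsBesselVector π Γ η →
      HasSum (fun γ : Γ => c γ • (π (γ : G) : H →L[ℂ] H) η) (T η) := by
  choose C hC using fun η : {η : H // IsBesselVector π Γ η} => η.2
  have hTstar : ∀ i j, Commute (adjoint T) (adjoint (C j) ∘L C i) := by
    intro i j
    have h := (hπ.commute_adjoint_comp (hC j) (hC i) hT).star_star
    rwa [star_eq_adjoint (adjoint (C i) ∘L C j), adjoint_comp, adjoint_adjoint] at h
  let A : ({η : H // IsBesselVector π Γ η} →₀ H) →ₗ[ℂ] lp (fun _ : Γ => ℂ) 2 :=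
    Finsupp.lsum ℂ fun i => (C i : H →ₗ[ℂ] lp (fun _ : Γ => ℂ) 2)
  let φ : ({η : H // IsBesselVector π Γ η} →₀ H) →ₗ[ℂ] ℂ :=
    Finsupp.lsum ℂ fun i => (innerSL ℂ (T i) : H →ₗ[ℂ] ℂ)
  have hφ : ∀ F, ‖φ F‖ ≤ ‖adjoint T‖ * ‖A F‖ := by
    intro F
    have h1 : φ F = (∑ i ∈ F.support, C i (adjoint T (F i)) : lp (fun _ : Γ => ℂ) 2) 1 := by
      rw [lp.coeFn_sum, Finset.sum_apply]
      refine Finset.sum_congr rfl fun i _ => ?_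
      rw [hC, adjoint_inner_right, OneMemClass.coe_one, hπ.map_one]
      rfl
    rw [h1]
    exact (lp.norm_apply_le_norm two_ne_zero _ _).trans
      (norm_sum_apply_le_of_commute C (adjoint T) hTstar F.support F)
  obtain ⟨c, hc⟩ := exists_inner_eq_of_norm_le A φ _ hφ
  refine ⟨c, lp.memℓp c, fun η hη => ?_⟩
  have h : adjoint (C ⟨η, hη⟩) c = T η := by
    refine ext_inner_right ℂ fun f => ?_
    have := hc (Finsupp.single ⟨η, hη⟩ f)
    rw [adjoint_inner_left]
    simpa [A, φ] using this
  rw [← h]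
  exact hasSum_smul_of_coeff (hC ⟨η, hη⟩) c

/-! ### Averaging over the finite subgroup -/

/-- Bessel vectors are invariant under `π(Γ)`. -/
theorem IsSigmaRep.isBesselVector_apply [MeasurableSpace G] (hπ : IsSigmaRep σ π) {η : H}
    (hη : IsBesselVector π Γ η) (l : Γ) :
    IsBesselVector π Γ ((π (l : G) : H →L[ℂ] H) η) := by
  obtain ⟨C, hC⟩ := hη
  have hw : ∀ γ : Γ, ‖conj (σ γ l : ℂ)‖ = 1 := fun γ => by
    rw [RCLike.norm_conj]
    exact Circle.norm_coe _
  -- Since `π(γ)π(l) = σ(γ, l)π(γl)`, the new coefficient map is `C` followed by this weighted right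
  -- translation.
  let U : lp (fun _ : Γ => ℂ) 2 →ₗ[ℂ] lp (fun _ : Γ => ℂ) 2 :=
    { toFun := fun a => ⟨fun γ => conj (σ γ l : ℂ) * a (Equiv.mulRight l γ),
        memℓp_two_mul_comp_equiv (lp.memℓp a) _ hw _⟩
      map_add' := fun a b => by ext γ; exact mul_add _ _ _
      map_smul' := fun r a => by ext γ; exact mul_left_comm _ _ _ }
  have hU : ∀ a, ‖U a‖ ≤ 1 * ‖a‖ := fun a => by
    have h2 : 0 < (2 : ℝ≥0∞).toReal := by norm_num
    rw [one_mul]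
    refine lp.norm_le_of_tsum_le h2 (norm_nonneg _) ?_
    rw [lp.norm_rpow_eq_tsum h2 a, ← (Equiv.mulRight l).tsum_eq fun γ => ‖a γ‖ ^ _]
    refine (tsum_congr fun γ => ?_).le
    change ‖conj (σ γ l : ℂ) * a (Equiv.mulRight l γ)‖ ^ _ = _
    rw [norm_mul, hw, one_mul]
  refine ⟨U.mkContinuous 1 hU ∘L C, fun f γ => ?_⟩
  rw [hπ.apply_apply, inner_smul_left, ← Subgroup.coe_mul, ← hC]
  rfl

theorem memℓp_averagedCoeff (Λ : Subgroup Γ) [Fintype Λ] (u : Λ → ℂ) {c : Γ → ℂ}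
    (hc : Memℓp c 2) : Memℓp (averagedCoeff σ Λ u c) 2 := by
  have h : ∀ l : Λ, Memℓp (fun γ : Γ => (σ ((γ * l : Γ) : G) (((l : Γ)⁻¹ : Γ) : G) : ℂ) *
      c (Equiv.mulRight (l : Γ) γ)) 2 := fun l =>
    memℓp_two_mul_comp_equiv hc _ (fun γ => Circle.norm_coe _) _
  convert Memℓp.const_smul (Memℓp.finsetSum Finset.univ fun l _ =>
    (h l).const_smul (conj (u l⁻¹))) (Fintype.card Λ : ℂ)⁻¹ using 1
  ext γ
  simp only [averagedCoeff, Pi.smul_apply, smul_eq_mul, Equiv.coe_mulRight]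
  exact congrArg _ (Finset.sum_congr rfl fun l _ => by ring)

/-- The series expansion of `T` yields that of `T` composed with the averaging operator. -/
theorem IsSigmaRep.hasSum_averagedCoeff [MeasurableSpace G] (hπ : IsSigmaRep σ π) (Λ : Subgroup Γ) [Fintype Λ]
    (u : Λ → ℂ) {T : H →L[ℂ] H} {c : Γ → ℂ}
    (hT : ∀ η : H, IsBesselVector π Γ η →
      HasSum (fun γ : Γ => c γ • (π (γ : G) : H →L[ℂ] H) η) (T η))
    {η : H} (hη : IsBesselVector π Γ η) :
    HasSum (fun γ : Γ => averagedCoeff σ Λ u c γ • (π (γ : G) : H →L[ℂ] H) η)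
      ((T * averagingOperator π Λ u) η) := by
  have h1 : ∀ l : Λ, HasSum (fun γ : Γ => (c (γ * l) *
      (σ ((γ * l : Γ) : G) (((l : Γ)⁻¹ : Γ) : G) : ℂ)) • (π (γ : G) : H →L[ℂ] H) η)
      (T ((π ((l⁻¹ : Λ) : Γ) : H →L[ℂ] H) η)) := by
    intro l
    have h := hT _ (hπ.isBesselVector_apply hη ((l⁻¹ : Λ) : Γ))
    -- Substituting `γ ↦ γl` gives `π(γl)π(l⁻¹) = σ(γl, l⁻¹)π(γ)`.
    rw [← (Equiv.mulRight (l : Γ)).hasSum_iff] at h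
    refine h.congr_fun fun γ => ?_
    simp only [Function.comp_apply, Equiv.coe_mulRight]
    rw [hπ.apply_apply, smul_smul, ← Subgroup.coe_mul, Subgroup.coe_inv Λ, mul_inv_cancel_right]
  have h2 := (hasSum_sum fun (l : Λ) (_ : l ∈ Finset.univ) =>
    (h1 l).const_smul (conj (u l⁻¹))).const_smul (Fintype.card Λ : ℂ)⁻¹
  have h3 : (T * averagingOperator π Λ u) η = (Fintype.card Λ : ℂ)⁻¹ •
      ∑ l : Λ, conj (u l⁻¹) • T ((π ((l⁻¹ : Λ) : Γ) : H →L[ℂ] H) η) := by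
    refine Eq.trans ?_ (congrArg _ (Equiv.sum_comp (Equiv.inv Λ) fun l : Λ =>
      conj (u l) • T ((π (l : Γ) : H →L[ℂ] H) η)).symm)
    simp [averagingOperator]
  rw [h3]
  refine h2.congr_fun fun γ => ?_
  simp only [averagedCoeff, smul_smul, ← Finset.sum_smul]
  congr 2
  exact Finset.sum_congr rfl fun l _ => by ring

end DiscreteSeriesLattice

theorem proposition3p3
    {G : Type*} [Group G] [TopologicalSpace G] [IsTopologicalGroup G] [LocallyCompactSpace G]
    [T2Space G] [SecondCountableTopology G] [MeasurableSpace G] [BorelSpace G]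
    (μ : Measure G) [μ.IsHaarMeasure] [μ.IsMulRightInvariant]
    {H : Type*} [NormedAddCommGroup H] [InnerProductSpace ℂ H] [CompleteSpace H]
    (σ : G → G → Circle) (π : G → unitary (H →L[ℂ] H))
    (hπ : DiscreteSeriesLattice.IsDiscreteSeries μ σ π)
    (Γ : Subgroup G) (hΓ : DiscreteSeriesLattice.IsLattice Γ) :
    (∀ T ∈ DiscreteSeriesLattice.bicommutant π Γ,
      ∃ c : Γ → ℂ, Memℓp c 2 ∧
        ∀ η : H, DiscreteSeriesLattice.IsBesselVector π Γ η →
          HasSum (fun γ : Γ => c γ • (π (γ : G) : H →L[ℂ] H) η) (T η)) ∧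
    (∀ (Λ : Subgroup Γ) [Fintype Λ] (u : Λ → ℂ),
      (∀ l m : Λ, (σ ((l : Γ) : G) ((m : Γ) : G) : ℂ) = u l * u m * conj (u (l * m))) →
      ∀ T ∈ DiscreteSeriesLattice.bicommutant π Γ,
      ∀ c : Γ → ℂ, Memℓp c 2 →
        (∀ η : H, DiscreteSeriesLattice.IsBesselVector π Γ η →
          HasSum (fun γ : Γ => c γ • (π (γ : G) : H →L[ℂ] H) η) (T η)) →
        Memℓp (DiscreteSeriesLattice.averagedCoeff σ Λ u c) 2 ∧
        ∀ η : H, DiscreteSeriesLattice.IsBesselVector π Γ η →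
          HasSum (fun γ : Γ => DiscreteSeriesLattice.averagedCoeff σ Λ u c γ •
              (π (γ : G) : H →L[ℂ] H) η)
            ((T * DiscreteSeriesLattice.averagingOperator π Λ u) η)) :=
  have h := hπ.isSigmaRep
  ⟨fun _ hT => h.exists_coeff hT, fun Λ _ u _ _ _ _ hc hT =>
    ⟨DiscreteSeriesLattice.memℓp_averagedCoeff Λ u hc,
      fun _ hη => h.hasSum_averagedCoeff Λ u hT hη⟩⟩
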